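/- Let $A\in\{0,1\}^{m\times n}$ be a zero-one matrix, let $b\in\mathbb{N}^m$ be a non-negative integral constraint vector, let $w\in\mathbb{R}^n$ be a weight vector, and let $X\in\mathbb{N}^n$ be a vector of upper bounds ($0\in\mathbb{N}$). The packing integer program is $\max\{w^Tx : Ax\le b,\ x\in\prod_i\{0,\dots,X_i\}\}$. Its LP relaxation, the packing LP, is $\max\{w^Tx : Ax\le b,\ x\in\prod_i[0,X_i]\}$, and $\mathrm{OPT}_{LP}$ is the set of optimal solutions of the packing LP. Let $G$ be the bipartite factor graph with variable vertices $v_1,\dots,v_n$, constraint vertices $C_1,\dots,C_m$, and an edge between $v_i$ and $C_j$ iff $A_{ji}=1$. Write $\mathcal{N}(\cdot)$ for neighborhoods in $G$ and $\varphi_{v_i}(\beta)=w_i\beta$; index the coordinates of vectors by the corresponding vertices. Min-sum-packing with zero initialization, run for $t\ge 0$ iterations, computes messages with values in $\mathbb{R}\cup\{-\infty\}$ along the edges $(v,C)$, for all $\beta\in\{0,\dots,X_v\}$, as follows. Initially $\mu^{(0)}_{C\to v}(\beta)=0$. For $t'=1,\dots,t$, $$\mu^{(t')}_{v\to C}(\beta)=\varphi_v(\beta)+\sum_{C'\in\mathcal{N}(v)\setminus\{C\}}\mu^{(t'-1)}_{C'\to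 v}(\beta),$$ $$\mu^{(t')}_{C\to v}(\beta)=\max\Big\{\sum_{u\in\mathcal{N}(C)\setminus\{v\}}\mu^{(t')}_{u\to C}(z_u)\ \Big|\ z\in\prod_i\{0,\dots,X_i\},\ z_v=\beta,\ \sum_{u\in\mathcal{N}(C)}z_u\le b_C\Big\},$$ where the maximum of the empty set is $-\infty$. Finally, $$\mu_v(\beta)=\varphi_v(\beta)+\sum_{C\in\mathcal{N}(v)}\mu^{(t)}_{C\to v}(\beta),$$ and $\delta_{v,t}$ is the set of all $\beta\in\{0,\dots,X_v\}$ that maximize $\mu_v(\beta)$ over $\{0,\dots,X_v\}$. Theorem (weak oscillation). For every variable vertex $r$ and every $t\ge 0$, all the maxima and minima below exist, and: 1. if $t$ is even, then $\max\delta_{r,t}\ \ge\ \max\{x_r : x\in\mathrm{OPT}_{LP}\}$; 2. if $t$ is odd, then $\min\delta_{r,t}\ \le\ \min\{x_r : x\in\mathrm{OPT}_{LP}\}$. -/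

import Mathlib

open scoped BigOperators

noncomputable section

namespace MinSum

/-- An instance of the packing problem: a zero-one constraint matrix `A` with `m` rows and `n`
columns, a non-negative integral constraint vector `b`, a real weight vector `w`, and a vector `X`
of upper bounds on the variables. -/
structure PackingInstance (m n : ℕ) where
  /-- the constraint matrix -/
  A : Matrix (Fin m) (Fin n) ℝ
  /-- the constraint matrix is zero-one -/
  zero_one : ∀ j i, A j i = 0 ∨ A j i = 1
  /-- the constraint vector -/
  b : Fin m → ℕ
  /-- the weight vector -/
  w : Fin n → ℝ
  /-- the box constraints -/
  X : Fin n → ℕ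

/-- The feasible region of the packing LP: `A x ≤ b` and `0 ≤ x ≤ X`. -/
def PackingInstance.lpFeasible {m n : ℕ} (P : PackingInstance m n) : Set (Fin n → ℝ) :=
  {x | P.A.mulVec x ≤ (fun j => (P.b j : ℝ)) ∧ ∀ i, 0 ≤ x i ∧ x i ≤ (P.X i : ℝ)}

/-- The set of optimal solutions of the packing LP (maximize `wᵀ x`). -/
def PackingInstance.optLP {m n : ℕ} (P : PackingInstance m n) : Set (Fin n → ℝ) :=
  {x | x ∈ P.lpFeasible ∧ ∀ y ∈ P.lpFeasible, P.w ⬝ᵥ y ≤ P.w ⬝ᵥ x}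

/-- A factor graph model `⟨G, Ψ, Φ, X⟩` with variable vertices `V` and constraint vertices `C`. The
values of the factor functions and of the messages are in `ℝ ∪ {-∞}`, that is `WithBot ℝ`. -/
structure FactorGraphModel (V C : Type*) where
  /-- the factor graph -/
  G : SimpleGraph (V ⊕ C)
  /-- the factor functions -/
  Ψ : C → (V → ℕ) → WithBot ℝ
  /-- the variable functions -/
  Φ : V → ℕ → ℝ
  /-- the alphabet of the variable vertex `v` is `{0, …, X v}` -/
  X : V → ℕ

/-- The bipartite graph that represents the matrix `A`: column `i` and row `j` are adjacent iff
`A j i = 1`. -/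
def PackingInstance.graph {m n : ℕ} (P : PackingInstance m n) :
    SimpleGraph (Fin n ⊕ Fin m) where
  Adj p q :=
    match p, q with
    | Sum.inl i, Sum.inr j => P.A j i = 1
    | Sum.inr j, Sum.inl i => P.A j i = 1
    | _, _ => False
  symm := ⟨by rintro (i | j) (i' | j') h <;> exact h⟩
  loopless := ⟨by rintro (i | j) h <;> exact h⟩

open Classical in
/-- The factor graph model of the packing integer program. -/
def PackingInstance.model {m n : ℕ} (P : PackingInstance m n) :
    FactorGraphModel (Fin n) (Fin m) where
  G := P.graph
  Ψ j y := if ∑ i with P.graph.Adj (Sum.inr j) (Sum.inl i), y i ≤ P.b j then 0 else ⊥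
  Φ i β := P.w i * (β : ℝ)
  X := P.X

namespace FactorGraphModel

variable {V C : Type*} [Fintype V] [Fintype C]

open Classical in
/-- The constraint vertices adjacent to the variable vertex `v`. -/
def varNbrs (M : FactorGraphModel V C) (v : V) : Finset C :=
  {c | M.G.Adj (Sum.inl v) (Sum.inr c)}

open Classical in
/-- The variable vertices adjacent to the constraint vertex `c`. -/
def conNbrs (M : FactorGraphModel V C) (c : C) : Finset V :=
  {v | M.G.Adj (Sum.inr c) (Sum.inl v)}

/-- The alphabet `{0, …, X v}` of the variable vertex `v`. -/
def alphabet (M : FactorGraphModel V C) (v : V) : Finset ℕ := Finset.range (M.X v + 1)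

open Classical in
/-- The integral assignments that satisfy the box constraints. -/
def zBox (M : FactorGraphModel V C) : Finset (V → ℕ) := Fintype.piFinset M.alphabet

open Classical in
/-- The message from `v` to `c` for the value `β`, computed from the constraint-to-variable
messages `μ` of the previous iteration. -/
def varMessage (M : FactorGraphModel V C) (μ : C → V → ℕ → WithBot ℝ) (v : V) (c : C) (β : ℕ) :
    WithBot ℝ :=
  (M.Φ v β : WithBot ℝ) + ∑ c' ∈ M.varNbrs v \ {c}, μ c' v β

open Classical in
/-- The message from `c` to `v` for the value `β` in iteration `t`; the maximum over the empty set
is `-∞`. The messages of iteration `0` are zero. -/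
def conMessage (M : FactorGraphModel V C) : ℕ → C → V → ℕ → WithBot ℝ
  | 0 => fun _ _ _ => 0
  | t + 1 => fun c v β =>
      (M.zBox.filter fun z => z v = β ∧ M.Ψ c z = 0).sup fun z =>
        ∑ u ∈ M.conNbrs c \ {v}, M.varMessage (M.conMessage t) u c (z u)

/-- The final value `μ_v(β)` computed by `v` for the value `β` after `t` iterations. -/
def finalValue (M : FactorGraphModel V C) (t : ℕ) (v : V) (β : ℕ) : WithBot ℝ :=
  (M.Φ v β : WithBot ℝ) + ∑ c ∈ M.varNbrs v, M.conMessage t c v β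

open Classical in
/-- The set `δ_{v,t}` of the values in the alphabet of `v` that maximize the final value. -/
def delta (M : FactorGraphModel V C) (t : ℕ) (v : V) : Finset ℕ :=
  (M.alphabet v).filter fun β => M.finalValue t v β = (M.alphabet v).sup (M.finalValue t v)

end FactorGraphModel

end MinSum

end

/-! Fix an LP optimum `x`, possibly fractional, and let `y ≥ 0` be optimal dual variables of the
constraints `A x ≤ b`. By complementary slackness, the sum of `y c` over the constraints at `v` is
at most `w v` if `0 < x v`, and at least `w v` if `x v < X v`; moreover `y c = 0` unless `c` is
tight at `x`.

Read `y c` as the price of one unit of `c`. By induction on `t` (`conMessage_oscillation`), at even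
`t` a step up from `β < x v` lowers a message `c → v` by at most `y c`; at odd `t` a step up to `β +
1 > x v` lowers it by at least `y c`. Each case yields the other by an exchange: changing `z v` by
one is offset at a second neighbour of `c` lying on the opposite side of `x`.

Summing over all constraints at `r`, the prices cancel against `w r`. So at even `t` the final value
does not drop on steps up from below `x r`, and at odd `t` it does not rise on steps up to values
above `x r`. Applying this to the `x` with extremal `x r` gives the theorem. -/

namespace MinSum

/-! ### Linear programming duality -/

/-- **Farkas' lemma** for finitely many linear functionals on an arbitrary real vector space. -/
theorem farkas {ι E : Type*} [AddCommGroup E] [Module ℝ E] (s : Finset ι) (a : ι → E →ₗ[ℝ] ℝ)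
    (w : E →ₗ[ℝ] ℝ) (h : ∀ x, (∀ k ∈ s, a k x ≤ 0) → w x ≤ 0) :
    ∃ l : ι → ℝ, (∀ k, 0 ≤ l k) ∧ (∀ k, k ∉ s → l k = 0) ∧ w = ∑ k ∈ s, l k • a k := by
  classical
  induction s using Finset.induction_on generalizing a w with
  | empty =>
    refine ⟨0, by simp, by simp, ?_⟩
    ext x
    have h1 := h x (by simp)
    have h2 := h (-x) (by simp)
    rw [map_neg] at h2
    simp
    linarith
  | insert j s hj ih =>
    by_cases hs : ∀ x, (∀ k ∈ s, a k x ≤ 0) → w x ≤ 0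
    · obtain ⟨l, h0, h1, h2⟩ := ih a w hs
      refine ⟨l, h0, fun k hk => h1 k fun hks => hk (Finset.mem_insert_of_mem hks), ?_⟩
      rw [Finset.sum_insert hj, h1 j hj, zero_smul, zero_add, h2]
    · push Not at hs
      obtain ⟨x₁, hx₁, hw₁⟩ := hs
      have hj₁ : 0 < a j x₁ := by
        by_contra hc
        refine (h x₁ fun k hk => ?_).not_gt hw₁
        rcases Finset.mem_insert.1 hk with rfl | hk
        · exact not_lt.1 hc
        · exact hx₁ k hk
      obtain ⟨x₀, hx₀, hw₀, hj₀⟩ : ∃ x₀, (∀ k ∈ s, a k x₀ ≤ 0) ∧ 0 < w x₀ ∧ a j x₀ = 1 := by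
        refine ⟨(a j x₁)⁻¹ • x₁, fun k hk => ?_, ?_, ?_⟩
        · simpa using mul_nonpos_of_nonneg_of_nonpos (inv_nonneg.2 hj₁.le) (hx₁ k hk)
        · simpa using mul_pos (inv_pos.2 hj₁) hw₁
        · simpa using inv_mul_cancel₀ hj₁.ne'
      -- The induction hypothesis is applied to the functionals composed with the projection `x ↦ x
      -- - a j x • x₀` onto the kernel of `a j`.
      obtain ⟨l, h0, h1, h2⟩ := ih (fun k => a k - a k x₀ • a j) (w - w x₀ • a j) (by
        intro x hx
        have := h (x - a j x • x₀) (by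
          intro k hk
          rcases Finset.mem_insert.1 hk with rfl | hk
          · simp [hj₀]
          · have := hx k hk
            simp at this ⊢
            linarith)
        simp at this ⊢
        linarith)
      refine ⟨Function.update l j (w x₀ - ∑ k ∈ s, l k * a k x₀), fun k => ?_, fun k hk => ?_, ?_⟩
      · rcases eq_or_ne k j with rfl | hk
        · rw [Function.update_self]
          have : ∑ i ∈ s, l i * a i x₀ ≤ 0 :=
            Finset.sum_nonpos fun i hi => mul_nonpos_of_nonneg_of_nonpos (h0 i) (hx₀ i hi)
          linarith
        · rw [Function.update_of_ne hk]
          exact h0 k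
      · rw [Finset.mem_insert, not_or] at hk
        rw [Function.update_of_ne hk.1]
        exact h1 k hk.2
      · rw [Finset.sum_insert hj, Function.update_self,
          Finset.sum_congr rfl (g := fun k => l k • a k) fun k hk => by
            rw [Function.update_of_ne (ne_of_mem_of_not_mem hk hj)]]
        ext x
        have := LinearMap.congr_fun h2 x
        simp [mul_sub, Finset.sum_sub_distrib, ← mul_assoc, ← Finset.sum_mul] at this ⊢
        linarith

/-- Optimality in a linear program with finitely many inequality constraints yields non-negative
multipliers that satisfy complementary slackness. -/
theorem exists_multipliers {ι E : Type*} [Fintype ι] [AddCommGroup E] [Module ℝ E]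
    (a : ι → E →ₗ[ℝ] ℝ) (c : ι → ℝ) (w : E →ₗ[ℝ] ℝ) (x : E) (hx : ∀ k, a k x ≤ c k)
    (hopt : ∀ y, (∀ k, a k y ≤ c k) → w y ≤ w x) :
    ∃ l : ι → ℝ, (∀ k, 0 ≤ l k) ∧ (∀ k, a k x < c k → l k = 0) ∧ w = ∑ k, l k • a k := by
  classical
  -- Only the active constraints enter: a direction `d` that respects them stays feasible for small
  -- steps, so `w d ≤ 0` by optimality.
  obtain ⟨l, h0, h1, h2⟩ := farkas (Finset.univ.filter fun k => a k x = c k) a w (by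
    intro d hd
    have key : ∀ k, ∀ᶠ ε : ℝ in nhdsWithin 0 (Set.Ioi 0), a k (x + ε • d) ≤ c k := by
      intro k
      rcases (hx k).eq_or_lt with hk | hk
      · filter_upwards [self_mem_nhdsWithin] with ε hε
        have := mul_nonpos_of_nonneg_of_nonpos (le_of_lt hε) (hd k (by simp [hk]))
        simp
        linarith
      · have ht : Filter.Tendsto (fun ε : ℝ => a k x + ε * a k d) (nhdsWithin 0 (Set.Ioi 0))
            (nhds (a k x)) := by
          have : Continuous fun ε : ℝ => a k x + ε * a k d := by fun_prop
          simpa using (this.tendsto 0).mono_left nhdsWithin_le_nhds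
        filter_upwards [ht.eventually (gt_mem_nhds hk)] with ε hε
        simpa using le_of_lt hε
    obtain ⟨ε, hε, hpos⟩ := ((Filter.eventually_all.2 key).and
      (self_mem_nhdsWithin : Set.Ioi (0 : ℝ) ∈ nhdsWithin 0 (Set.Ioi 0))).exists
    have hle := hopt _ hε
    simp only [map_add, map_smul, smul_eq_mul, add_le_iff_nonpos_right] at hle
    exact nonpos_of_mul_nonpos_right hle hpos)
  refine ⟨l, h0, fun k hk => h1 k (by simp [hk.ne]), h2.trans ?_⟩
  refine Finset.sum_subset (Finset.subset_univ _) fun k _ hk => ?_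
  rw [h1 k hk, zero_smul]

theorem sup_add_le {α : Type*} {s : Finset α} {f : α → WithBot ℝ} {y B : WithBot ℝ}
    (h : ∀ z ∈ s, f z + y ≤ B) : s.sup f + y ≤ B := by
  rcases s.eq_empty_or_nonempty with rfl | hs
  · simp
  · obtain ⟨z, hz, he⟩ := Finset.exists_mem_eq_sup s hs f
    rw [he]
    exact h z hz

namespace PackingInstance

variable {m n : ℕ}

/-! ### Existence of LP optima -/

theorem isCompact_lpFeasible (P : PackingInstance m n) : IsCompact P.lpFeasible := by
  refine (isCompact_univ_pi fun i => isCompact_Icc (a := (0 : ℝ)) (b := P.X i)).of_isClosed_subset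
    ?_ fun x hx i _ => hx.2 i
  have h1 : IsClosed {x : Fin n → ℝ | P.A.mulVec x ≤ fun j => (P.b j : ℝ)} :=
    isClosed_le (by fun_prop) continuous_const
  have h2 : IsClosed {x : Fin n → ℝ | ∀ i, 0 ≤ x i ∧ x i ≤ (P.X i : ℝ)} := by
    simp only [Set.ofPred_forall]
    exact isClosed_iInter fun i => (isClosed_le continuous_const (continuous_apply i)).inter
      (isClosed_le (continuous_apply i) continuous_const)
  exact h1.inter h2

theorem zero_mem_lpFeasible (P : PackingInstance m n) : (0 : Fin n → ℝ) ∈ P.lpFeasible :=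
  ⟨fun j => by simp, fun i => by simp⟩

theorem continuous_weight (P : PackingInstance m n) : Continuous fun x : Fin n → ℝ => P.w ⬝ᵥ x := by
  unfold dotProduct
  fun_prop

theorem isCompact_optLP (P : PackingInstance m n) : IsCompact P.optLP := by
  have : P.optLP = P.lpFeasible ∩ ⋂ y ∈ P.lpFeasible, {x | P.w ⬝ᵥ y ≤ P.w ⬝ᵥ x} := by
    ext x
    simp [optLP]
  rw [this]
  exact P.isCompact_lpFeasible.inter_right <| isClosed_biInter fun y _ =>
    isClosed_le continuous_const P.continuous_weight

theorem optLP_nonempty (P : PackingInstance m n) : P.optLP.Nonempty := by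
  obtain ⟨x, hx, hmax⟩ := P.isCompact_lpFeasible.exists_isMaxOn ⟨0, P.zero_mem_lpFeasible⟩
    P.continuous_weight.continuousOn
  exact ⟨x, hx, fun y hy => hmax hy⟩

theorem image_optLP (P : PackingInstance m n) (r : Fin n) :
    IsCompact {a | ∃ x ∈ P.optLP, x r = a} ∧ {a | ∃ x ∈ P.optLP, x r = a}.Nonempty :=
  ⟨P.isCompact_optLP.image (continuous_apply r), P.optLP_nonempty.image fun x : Fin n → ℝ => x r⟩

/-! ### Neighbourhoods in the factor graph in terms of `A` -/

theorem mem_varNbrs (P : PackingInstance m n) {v : Fin n} {c : Fin m} :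
    c ∈ P.model.varNbrs v ↔ P.A c v = 1 := by
  classical
  unfold FactorGraphModel.varNbrs
  rw [Finset.mem_filter]
  exact and_iff_right (Finset.mem_univ c)

theorem mem_conNbrs (P : PackingInstance m n) {v : Fin n} {c : Fin m} :
    v ∈ P.model.conNbrs c ↔ P.A c v = 1 := by
  classical
  unfold FactorGraphModel.conNbrs
  rw [Finset.mem_filter]
  exact and_iff_right (Finset.mem_univ v)

theorem sum_conNbrs (P : PackingInstance m n) (c : Fin m) (x : Fin n → ℝ) :
    ∑ u ∈ P.model.conNbrs c, x u = P.A.mulVec x c := by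
  simp only [Matrix.mulVec, dotProduct]
  rw [← Finset.sum_subset (Finset.subset_univ (P.model.conNbrs c))]
  · exact Finset.sum_congr rfl fun u hu => by rw [P.mem_conNbrs.1 hu, one_mul]
  · intro u _ hu
    rw [(P.zero_one c u).resolve_right fun h => hu (P.mem_conNbrs.2 h), zero_mul]

theorem sum_varNbrs (P : PackingInstance m n) (v : Fin n) (y : Fin m → ℝ) :
    ∑ c ∈ P.model.varNbrs v, y c = ∑ c, y c * P.A c v := by
  rw [← Finset.sum_subset (Finset.subset_univ (P.model.varNbrs v))]
  · exact Finset.sum_congr rfl fun c hc => by rw [P.mem_varNbrs.1 hc, mul_one]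
  · intro c _ hc
    rw [(P.zero_one c v).resolve_right fun h => hc (P.mem_varNbrs.2 h), mul_zero]

theorem model_Ψ_eq_zero (P : PackingInstance m n) {c : Fin m} {z : Fin n → ℕ} :
    P.model.Ψ c z = 0 ↔ ∑ u ∈ P.model.conNbrs c, z u ≤ P.b c := by
  classical
  have : P.model.Ψ c z = if ∑ u ∈ P.model.conNbrs c, z u ≤ P.b c then 0 else ⊥ := rfl
  rw [this]
  split_ifs with h <;> simp [h]

theorem mem_zBox (P : PackingInstance m n) {z : Fin n → ℕ} :
    z ∈ P.model.zBox ↔ ∀ u, z u ≤ P.X u := by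
  simp [FactorGraphModel.zBox, FactorGraphModel.alphabet, model]

/-! ### Dual certificates -/

/-- A certificate `y` that `x` is optimal for the packing LP: the dual variables of the box
constraints are eliminated. -/
structure IsDualCertificate (P : PackingInstance m n) (x : Fin n → ℝ) (y : Fin m → ℝ) : Prop where
  feasible : x ∈ P.lpFeasible
  nonneg : ∀ c, 0 ≤ y c
  slack : ∀ c, P.A.mulVec x c < P.b c → y c = 0
  le_weight : ∀ v, 0 < x v → ∑ c ∈ P.model.varNbrs v, y c ≤ P.w v
  weight_le : ∀ v, x v < P.X v → P.w v ≤ ∑ c ∈ P.model.varNbrs v, y c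

theorem exists_isDualCertificate (P : PackingInstance m n) {x : Fin n → ℝ} (hx : x ∈ P.optLP) :
    ∃ y, P.IsDualCertificate x y := by
  let a : Fin m ⊕ Fin n ⊕ Fin n → (Fin n → ℝ) →ₗ[ℝ] ℝ :=
    Sum.elim (fun c => LinearMap.proj c ∘ₗ P.A.mulVecLin)
      (Sum.elim (fun i => LinearMap.proj i) fun i => -LinearMap.proj i)
  let b : Fin m ⊕ Fin n ⊕ Fin n → ℝ :=
    Sum.elim (fun c => (P.b c : ℝ)) (Sum.elim (fun i => (P.X i : ℝ)) fun _ => 0)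
  have hfeas : ∀ y, (∀ k, a k y ≤ b k) ↔ y ∈ P.lpFeasible := by
    intro y
    simp only [a, b, lpFeasible, Sum.forall, Set.mem_ofPred_eq, Pi.le_def]
    simp [forall_and, and_comm]
  let w : (Fin n → ℝ) →ₗ[ℝ] ℝ := dotProductBilin ℝ ℝ P.w
  obtain ⟨l, h0, h1, h2⟩ := exists_multipliers a b w x ((hfeas x).2 hx.1)
    fun y hy => hx.2 y ((hfeas y).1 hy)
  have hw : ∀ v, P.w v = ∑ c ∈ P.model.varNbrs v, l (.inl c) + l (.inr (.inl v))
      - l (.inr (.inr v)) := by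
    intro v
    -- Evaluation at a unit vector gives the dual equation of column `v`.
    have := LinearMap.congr_fun h2 (Pi.single v 1)
    simp [a, w, Pi.single_apply, Fintype.sum_sum_type] at this
    rw [this, P.sum_varNbrs v fun c => l (.inl c)]
    ring
  refine ⟨fun c => l (.inl c), hx.1, fun c => h0 _, fun c hc => h1 _ hc, fun v hv => ?_,
    fun v hv => ?_⟩
  · have := h1 (.inr (.inr v)) (by simpa [a, b] using hv)
    have := h0 (.inr (.inl v))
    linarith [hw v]
  · have := h1 (.inr (.inl v)) hv
    have := h0 (.inr (.inr v))
    linarith [hw v]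

/-! ### Oscillation of the messages around `x` -/

section Messages

variable {P : PackingInstance m n} {x : Fin n → ℝ} {y : Fin m → ℝ}
  {μ : Fin m → Fin n → ℕ → WithBot ℝ}

theorem Φ_succ (P : PackingInstance m n) (v : Fin n) (β : ℕ) :
    (P.model.Φ v (β + 1) : WithBot ℝ) = P.model.Φ v β + P.w v := by
  rw [← WithBot.coe_add]
  congr 1
  simp [model]
  ring

theorem coe_sum_withBot {α : Type*} (s : Finset α) (f : α → ℝ) :
    ((∑ i ∈ s, f i : ℝ) : WithBot ℝ) = ∑ i ∈ s, (f i : WithBot ℝ) := by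
  classical
  induction s using Finset.induction_on with
  | empty => simp
  | insert a s ha ih => rw [Finset.sum_insert ha, Finset.sum_insert ha, WithBot.coe_add, ih]

/-- The beliefs of `v`, computed from the constraints in `s`, increase with `β` if the messages do
so up to an error `y`. -/
theorem belief_le_succ {v : Fin n} {β : ℕ} (s : Finset (Fin m)) (e : ℝ)
    (hw : ∑ c ∈ s, y c + e ≤ P.w v)
    (hμ : ∀ c ∈ s, μ c v β ≤ μ c v (β + 1) + y c) :
    (P.model.Φ v β : WithBot ℝ) + ∑ c ∈ s, μ c v β + e ≤
      P.model.Φ v (β + 1) + ∑ c ∈ s, μ c v (β + 1) := by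
  calc (P.model.Φ v β : WithBot ℝ) + ∑ c ∈ s, μ c v β + e
      ≤ P.model.Φ v β + ∑ c ∈ s, (μ c v (β + 1) + y c) + e := by
        gcongr with c hc; exact hμ c hc
    _ = P.model.Φ v β + ((∑ c ∈ s, y c + e : ℝ) : WithBot ℝ) + ∑ c ∈ s, μ c v (β + 1) := by
        rw [Finset.sum_add_distrib, WithBot.coe_add, coe_sum_withBot]; abel
    _ ≤ P.model.Φ v β + P.w v + ∑ c ∈ s, μ c v (β + 1) := by
        gcongr; exact WithBot.coe_le_coe.2 hw
    _ = _ := by rw [Φ_succ]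

theorem belief_succ_le {v : Fin n} {β : ℕ} (s : Finset (Fin m)) (e : ℝ)
    (hw : P.w v ≤ ∑ c ∈ s, y c + e)
    (hμ : ∀ c ∈ s, μ c v (β + 1) + y c ≤ μ c v β) :
    (P.model.Φ v (β + 1) : WithBot ℝ) + ∑ c ∈ s, μ c v (β + 1) ≤
      P.model.Φ v β + ∑ c ∈ s, μ c v β + e := by
  calc (P.model.Φ v (β + 1) : WithBot ℝ) + ∑ c ∈ s, μ c v (β + 1)
      = P.model.Φ v β + P.w v + ∑ c ∈ s, μ c v (β + 1) := by rw [Φ_succ]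
    _ ≤ P.model.Φ v β + ((∑ c ∈ s, y c + e : ℝ) : WithBot ℝ) + ∑ c ∈ s, μ c v (β + 1) := by
        gcongr; exact WithBot.coe_le_coe.2 hw
    _ = P.model.Φ v β + ∑ c ∈ s, (μ c v (β + 1) + y c) + e := by
        rw [Finset.sum_add_distrib, WithBot.coe_add, coe_sum_withBot]; abel
    _ ≤ _ := by gcongr with c hc; exact hμ c hc

theorem varMessage_eq (v : Fin n) (c : Fin m) (β : ℕ) :
    P.model.varMessage μ v c β =
      P.model.Φ v β + ∑ c' ∈ (P.model.varNbrs v).erase c, μ c' v β := by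
  unfold FactorGraphModel.varMessage
  congr 2
  ext
  simp [and_comm]

open Classical in
theorem conMessage_succ (t : ℕ) (c : Fin m) (v : Fin n) (β : ℕ) :
    P.model.conMessage (t + 1) c v β =
      (P.model.zBox.filter fun z => z v = β ∧ P.model.Ψ c z = 0).sup fun z =>
        ∑ u ∈ (P.model.conNbrs c).erase v,
          P.model.varMessage (P.model.conMessage t) u c (z u) := by
  rw [FactorGraphModel.conMessage]
  congr! 4
  ext
  simp [and_comm]

/-- The message to `c` omits `c`, so the price `y c` is left over from the dual inequality at `v`.
-/
theorem IsDualCertificate.varMessage_le_succ (h : P.IsDualCertificate x y) {v : Fin n} {c : Fin m}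
    (hc : c ∈ P.model.varNbrs v) {β : ℕ} (hβ : (β : ℝ) < x v)
    (hμ : ∀ c ∈ P.model.varNbrs v, μ c v β ≤ μ c v (β + 1) + y c) :
    P.model.varMessage μ v c β + y c ≤ P.model.varMessage μ v c (β + 1) := by
  rw [varMessage_eq, varMessage_eq]
  refine belief_le_succ (y := y) ((P.model.varNbrs v).erase c) (y c) ?_ ?_
  · rw [Finset.sum_erase_add _ _ hc]
    exact h.le_weight v (hβ.trans_le' (Nat.cast_nonneg _))
  · exact fun c' hc' => hμ c' (Finset.mem_of_mem_erase hc')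

theorem IsDualCertificate.varMessage_succ_le (h : P.IsDualCertificate x y) {v : Fin n} {c : Fin m}
    (hc : c ∈ P.model.varNbrs v) {β : ℕ} (hβX : β + 1 ≤ P.X v) (hβ : x v < (β + 1 : ℕ))
    (hμ : ∀ c ∈ P.model.varNbrs v, μ c v (β + 1) + y c ≤ μ c v β) :
    P.model.varMessage μ v c (β + 1) ≤ P.model.varMessage μ v c β + y c := by
  rw [varMessage_eq, varMessage_eq]
  refine belief_succ_le (y := y) ((P.model.varNbrs v).erase c) (y c) ?_ ?_
  · rw [Finset.sum_erase_add _ _ hc]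
    exact h.weight_le v (hβ.trans_le (by exact_mod_cast hβX))
  · exact fun c' hc' => hμ c' (Finset.mem_of_mem_erase hc')

theorem le_conMessage_succ {t : ℕ} {c : Fin m} {v : Fin n} {z : Fin n → ℕ}
    (hz : ∀ u, z u ≤ P.X u) (hb : ∑ u ∈ P.model.conNbrs c, z u ≤ P.b c) :
    ∑ u ∈ (P.model.conNbrs c).erase v, P.model.varMessage (P.model.conMessage t) u c (z u) ≤
      P.model.conMessage (t + 1) c v (z v) := by
  rw [conMessage_succ]
  refine Finset.le_sup (f := fun z : Fin n → ℕ => ∑ u ∈ (P.model.conNbrs c).erase v,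
    P.model.varMessage (P.model.conMessage t) u c (z u)) (b := z) ?_
  simp [P.mem_zBox, P.model_Ψ_eq_zero, hz, hb]

theorem sum_update_of_mem {α N : Type*} [DecidableEq α] [AddCommMonoid N] {s : Finset α}
    {u : α} (hu : u ∈ s) (f : α → ℕ → N) (z : α → ℕ) (k : ℕ) :
    ∑ i ∈ s, f i (Function.update z u k i) = f u k + ∑ i ∈ s.erase u, f i (z i) := by
  rw [← Finset.add_sum_erase _ _ hu, Function.update_self]
  congr 1
  exact Finset.sum_congr rfl fun i hi => by rw [Function.update_of_ne (Finset.ne_of_mem_erase hi)]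

theorem sum_erase_update {α N : Type*} [DecidableEq α] [AddCommMonoid N] (s : Finset α)
    (v : α) (f : α → ℕ → N) (z : α → ℕ) (k : ℕ) :
    ∑ i ∈ s.erase v, f i (Function.update z v k i) = ∑ i ∈ s.erase v, f i (z i) :=
  Finset.sum_congr rfl fun i hi => by
    rw [Function.update_of_ne (Finset.ne_of_mem_erase hi)]

/-- No bound `β + 1 ≤ P.X v` is needed: beyond the alphabet the message is `⊥`. -/
theorem IsDualCertificate.conMessage_succ_step (h : P.IsDualCertificate x y) {t : ℕ} {c : Fin m}
    {v : Fin n} (hv : v ∈ P.model.conNbrs c) {β : ℕ} (hβ : x v < (β + 1 : ℕ))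
    (hvar : ∀ u ∈ P.model.conNbrs c, ∀ γ : ℕ, (γ : ℝ) < x u →
      P.model.varMessage (P.model.conMessage t) u c γ + y c ≤
        P.model.varMessage (P.model.conMessage t) u c (γ + 1)) :
    P.model.conMessage (t + 1) c v (β + 1) + y c ≤ P.model.conMessage (t + 1) c v β := by
  classical
  rw [conMessage_succ]
  refine sup_add_le fun z hz => ?_
  simp only [Finset.mem_filter, P.mem_zBox, P.model_Ψ_eq_zero] at hz
  obtain ⟨hbox, hzv, hb⟩ := hz
  set z₁ := Function.update z v β with hz₁
  have hz₁v : z₁ v = β := Function.update_self ..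
  have hbox₁ : ∀ u, z₁ u ≤ P.X u := by
    intro u
    rcases eq_or_ne u v with rfl | hu
    · have := hbox u
      omega
    · rw [hz₁, Function.update_of_ne hu]
      exact hbox u
  have hsum₁ : ∑ u ∈ P.model.conNbrs c, z₁ u + 1 = ∑ u ∈ P.model.conNbrs c, z u := by
    rw [hz₁, sum_update_of_mem hv fun _ k => k, ← Finset.add_sum_erase _ _ hv, hzv]
    ring
  -- The objective of a message to `v` does not involve `z v`.
  rw [← sum_erase_update (P.model.conNbrs c) v
    (fun u => P.model.varMessage (P.model.conMessage t) u c) z β, ← hz₁]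
  by_cases hy : y c = 0
  · rw [hy, WithBot.coe_zero, add_zero]
    convert le_conMessage_succ (v := v) hbox₁ (by omega : ∑ u ∈ P.model.conNbrs c, z₁ u ≤ P.b c)
    exact hz₁v.symm
  -- A positive price makes `c` tight at `x`. Since `z₁ v = β > x v - 1`, some other `u` has `z₁ u <
  -- x u`; raising it by one uses the freed unit and gains at least `y c`.
  · have hlt : ∑ u ∈ P.model.conNbrs c, (z₁ u : ℝ) + 1 ≤ ∑ u ∈ P.model.conNbrs c, x u := by
      rw [P.sum_conNbrs c x]
      refine le_trans ?_ (not_lt.1 (mt (h.slack c) hy))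
      exact_mod_cast hsum₁.trans_le hb
    obtain ⟨u, hu, huv, hux⟩ : ∃ u ∈ P.model.conNbrs c, u ≠ v ∧ (z₁ u : ℝ) < x u := by
      by_contra! hc
      have h1 : ∑ u ∈ (P.model.conNbrs c).erase v, x u ≤
          ∑ u ∈ (P.model.conNbrs c).erase v, (z₁ u : ℝ) :=
        Finset.sum_le_sum fun u hu => hc u (Finset.mem_of_mem_erase hu) (Finset.ne_of_mem_erase hu)
      rw [← Finset.add_sum_erase _ _ hv, ← Finset.add_sum_erase _ _ hv, hz₁v] at hlt
      push_cast at hβ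
      linarith
    have huX : z₁ u + 1 ≤ P.X u := by
      exact_mod_cast hux.trans_le (h.feasible.2 u).2
    have hu' : u ∈ (P.model.conNbrs c).erase v := by simp [hu, huv]
    have key := le_conMessage_succ (P := P) (t := t) (c := c) (v := v)
      (z := Function.update z₁ u (z₁ u + 1))
      (by
        intro i
        rcases eq_or_ne i u with rfl | hi
        · rwa [Function.update_self]
        · rw [Function.update_of_ne hi]
          exact hbox₁ i)
      (by
        rw [sum_update_of_mem hu fun _ k => k]
        rw [← Finset.add_sum_erase _ _ hu] at hsum₁
        omega)
    rw [Function.update_of_ne huv.symm, hz₁v] at key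
    refine le_trans ?_ key
    rw [sum_update_of_mem hu' fun u => P.model.varMessage (P.model.conMessage t) u c,
      ← Finset.add_sum_erase _ _ hu', add_right_comm]
    gcongr
    exact hvar u hu _ hux

theorem IsDualCertificate.conMessage_le_succ_step (h : P.IsDualCertificate x y) {t : ℕ} {c : Fin m}
    {v : Fin n} (hv : v ∈ P.model.conNbrs c) {β : ℕ} (hβ : (β : ℝ) < x v)
    (hvar : ∀ u ∈ P.model.conNbrs c, ∀ γ : ℕ, γ + 1 ≤ P.X u → x u < (γ + 1 : ℕ) →
      P.model.varMessage (P.model.conMessage t) u c (γ + 1) ≤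
        P.model.varMessage (P.model.conMessage t) u c γ + y c) :
    P.model.conMessage (t + 1) c v β ≤ P.model.conMessage (t + 1) c v (β + 1) + y c := by
  classical
  rw [conMessage_succ]
  refine Finset.sup_le fun z hz => ?_
  simp only [Finset.mem_filter, P.mem_zBox, P.model_Ψ_eq_zero] at hz
  obtain ⟨hbox, hzv, hb⟩ := hz
  have hβX : β + 1 ≤ P.X v := by
    exact_mod_cast hβ.trans_le (h.feasible.2 v).2
  set z₁ := Function.update z v (β + 1) with hz₁
  have hz₁v : z₁ v = β + 1 := Function.update_self ..
  have hbox₁ : ∀ u, z₁ u ≤ P.X u := by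
    intro u
    rcases eq_or_ne u v with rfl | hu
    · rwa [hz₁v]
    · rw [hz₁, Function.update_of_ne hu]
      exact hbox u
  have hsum₁ : ∑ u ∈ P.model.conNbrs c, z₁ u = ∑ u ∈ P.model.conNbrs c, z u + 1 := by
    rw [hz₁, sum_update_of_mem hv fun _ k => k, ← Finset.add_sum_erase _ _ hv, hzv]
    ring
  rw [← sum_erase_update (P.model.conNbrs c) v
    (fun u => P.model.varMessage (P.model.conMessage t) u c) z (β + 1), ← hz₁]
  by_cases hb₁ : ∑ u ∈ P.model.conNbrs c, z₁ u ≤ P.b c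
  · have key := le_conMessage_succ (P := P) (t := t) (v := v) hbox₁ hb₁
    rw [hz₁v] at key
    refine le_trans (by convert key) (le_add_of_nonneg_right ?_)
    exact_mod_cast h.nonneg c
  -- Now `z₁` exceeds the capacity by one while `z₁ v < x v + 1`, so some other `u` has `z₁ u > x
  -- u`; lowering it by one restores feasibility at a cost of at most `y c`.
  · have hlt : ∑ u ∈ P.model.conNbrs c, x u + 1 ≤ ∑ u ∈ P.model.conNbrs c, (z₁ u : ℝ) := by
      rw [P.sum_conNbrs c x]
      have h1 := h.feasible.1 c
      have h2 : (P.b c : ℝ) + 1 ≤ ∑ u ∈ P.model.conNbrs c, (z₁ u : ℝ) := by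
        exact_mod_cast not_le.1 hb₁
      linarith
    obtain ⟨u, hu, huv, hux⟩ : ∃ u ∈ P.model.conNbrs c, u ≠ v ∧ x u < (z₁ u : ℝ) := by
      by_contra! hc
      have h1 : ∑ u ∈ (P.model.conNbrs c).erase v, (z₁ u : ℝ) ≤
          ∑ u ∈ (P.model.conNbrs c).erase v, x u :=
        Finset.sum_le_sum fun u hu => hc u (Finset.mem_of_mem_erase hu) (Finset.ne_of_mem_erase hu)
      rw [← Finset.add_sum_erase _ _ hv, ← Finset.add_sum_erase _ _ hv, hz₁v] at hlt
      push_cast at hlt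
      linarith
    obtain ⟨γ, hγ⟩ : ∃ γ, z₁ u = γ + 1 := Nat.exists_eq_succ_of_ne_zero fun h0 => by
      rw [h0, Nat.cast_zero] at hux
      exact hux.not_ge (h.feasible.2 u).1
    have hu' : u ∈ (P.model.conNbrs c).erase v := by simp [hu, huv]
    have key := le_conMessage_succ (P := P) (t := t) (c := c) (v := v)
      (z := Function.update z₁ u γ)
      (by
        intro i
        rcases eq_or_ne i u with rfl | hi
        · rw [Function.update_self]
          have := hbox₁ i
          omega
        · rw [Function.update_of_ne hi]
          exact hbox₁ i)
      (by
        rw [sum_update_of_mem hu fun _ k => k]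
        rw [← Finset.add_sum_erase _ _ hu] at hsum₁
        omega)
    rw [Function.update_of_ne huv.symm, hz₁v] at key
    refine le_trans ?_ (add_le_add_left key _)
    rw [sum_update_of_mem hu' fun u => P.model.varMessage (P.model.conMessage t) u c,
      ← Finset.add_sum_erase _ _ hu', add_right_comm, hγ]
    gcongr
    exact hvar u hu γ (hγ ▸ hbox₁ u) (hγ ▸ hux)

/-- The messages of even iterations favour values above the LP solution `x`, and those of odd
iterations favour values below `x`, up to the dual variables. -/
theorem IsDualCertificate.conMessage_oscillation (h : P.IsDualCertificate x y) (t : ℕ) :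
    (Even t → ∀ c v, P.A c v = 1 → ∀ β : ℕ, (β : ℝ) < x v →
      P.model.conMessage t c v β ≤ P.model.conMessage t c v (β + 1) + y c) ∧
    (Odd t → ∀ c v, P.A c v = 1 → ∀ β : ℕ, x v < (β + 1 : ℕ) →
      P.model.conMessage t c v (β + 1) + y c ≤ P.model.conMessage t c v β) := by
  induction t with
  | zero =>
    refine ⟨fun _ c v _ β _ => ?_, fun h0 => absurd h0 (by simp)⟩
    simp only [FactorGraphModel.conMessage, zero_add]
    exact_mod_cast h.nonneg c
  | succ t ih =>
    refine ⟨fun ht c v hcv β hβ => ?_, fun ht c v hcv β hβ => ?_⟩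
    · have ht' : Odd t := by
        rwa [Nat.even_add_one, Nat.not_even_iff_odd] at ht
      exact h.conMessage_le_succ_step (P.mem_conNbrs.2 hcv) hβ fun u hu γ hγX hγ =>
        h.varMessage_succ_le (P.mem_varNbrs.2 (P.mem_conNbrs.1 hu)) hγX hγ fun c' hc' =>
          ih.2 ht' c' u (P.mem_varNbrs.1 hc') γ hγ
    · have ht' : Even t := by
        rwa [Nat.odd_add_one, Nat.not_odd_iff_even] at ht
      exact h.conMessage_succ_step (P.mem_conNbrs.2 hcv) hβ fun u hu γ hγ =>
        h.varMessage_le_succ (P.mem_varNbrs.2 (P.mem_conNbrs.1 hu)) hγ fun c' hc' =>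
          ih.1 ht' c' u (P.mem_varNbrs.1 hc') γ hγ

theorem IsDualCertificate.finalValue_le_succ (h : P.IsDualCertificate x y) {t : ℕ} (ht : Even t)
    {v : Fin n} {β : ℕ} (hβ : (β : ℝ) < x v) :
    P.model.finalValue t v β ≤ P.model.finalValue t v (β + 1) := by
  have := belief_le_succ (μ := P.model.conMessage t) (P := P) (y := y) (v := v) (β := β)
    (P.model.varNbrs v) 0
    (by simpa using h.le_weight v (hβ.trans_le' (Nat.cast_nonneg _)))
    fun c hc => (h.conMessage_oscillation t).1 ht c v (P.mem_varNbrs.1 hc) β hβ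
  simpa [FactorGraphModel.finalValue] using this

theorem IsDualCertificate.finalValue_succ_le (h : P.IsDualCertificate x y) {t : ℕ} (ht : Odd t)
    {v : Fin n} {β : ℕ} (hβX : β + 1 ≤ P.X v) (hβ : x v < (β + 1 : ℕ)) :
    P.model.finalValue t v (β + 1) ≤ P.model.finalValue t v β := by
  have := belief_succ_le (μ := P.model.conMessage t) (P := P) (y := y) (v := v) (β := β)
    (P.model.varNbrs v) 0
    (by simpa using h.weight_le v (hβ.trans_le (by exact_mod_cast hβX)))
    fun c hc => (h.conMessage_oscillation t).2 ht c v (P.mem_varNbrs.1 hc) β hβ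
  simpa [FactorGraphModel.finalValue] using this

end Messages

/-! ### Maximizers of the final values -/

theorem mem_delta (P : PackingInstance m n) {t : ℕ} {v : Fin n} {β : ℕ} :
    β ∈ P.model.delta t v ↔ β ≤ P.X v ∧
      ∀ γ ≤ P.X v, P.model.finalValue t v γ ≤ P.model.finalValue t v β := by
  have hX : ∀ γ, γ ∈ P.model.alphabet v ↔ γ ≤ P.X v := fun γ => by
    simp [FactorGraphModel.alphabet, model]
  simp only [FactorGraphModel.delta, Finset.mem_filter, hX]
  refine and_congr_right fun hβ => ⟨fun he γ hγ => ?_, fun hmax => le_antisymm ?_ ?_⟩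
  · exact he ▸ Finset.le_sup ((hX γ).2 hγ)
  · exact Finset.le_sup (f := P.model.finalValue t v) ((hX β).2 hβ)
  · exact Finset.sup_le fun γ hγ => hmax γ ((hX γ).1 hγ)

theorem delta_nonempty (P : PackingInstance m n) (t : ℕ) (v : Fin n) :
    (P.model.delta t v).Nonempty := by
  obtain ⟨β, hβ, hmax⟩ := Finset.exists_max_image (Finset.Iic (P.X v)) (P.model.finalValue t v)
    ⟨0, by simp⟩
  exact ⟨β, P.mem_delta.2 ⟨Finset.mem_Iic.1 hβ, fun γ hγ => hmax γ (Finset.mem_Iic.2 hγ)⟩⟩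

end PackingInstance

end MinSum

theorem theorem1 {m n : ℕ} (P : MinSum.PackingInstance m n) (t : ℕ) (r : Fin n) :
    (Even t → ∃ (βmax : ℕ) (xmax : ℝ),
      IsGreatest {β | β ∈ P.model.delta t r} βmax ∧
      IsGreatest {a | ∃ x ∈ P.optLP, x r = a} xmax ∧
      xmax ≤ (βmax : ℝ)) ∧
    (Odd t → ∃ (βmin : ℕ) (xmin : ℝ),
      IsLeast {β | β ∈ P.model.delta t r} βmin ∧
      IsLeast {a | ∃ x ∈ P.optLP, x r = a} xmin ∧
      (βmin : ℝ) ≤ xmin) := by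
  obtain ⟨hcomp, hne⟩ := P.image_optLP r
  refine ⟨fun ht => ?_, fun ht => ?_⟩
  · obtain ⟨a, ha⟩ := hcomp.exists_isGreatest hne
    have hβ := (P.model.delta t r).isGreatest_max' (P.delta_nonempty t r)
    refine ⟨_, a, hβ, ha, ?_⟩
    set β := (P.model.delta t r).max' (P.delta_nonempty t r)
    obtain ⟨x, hx, rfl⟩ := ha.1
    obtain ⟨y, h⟩ := P.exists_isDualCertificate hx
    by_contra! hlt
    have hX : β + 1 ≤ P.X r := by
      exact_mod_cast hlt.trans_le (h.feasible.2 r).2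
    -- If `β < x r`, then `β + 1` is also a maximizer, against the choice of `β`.
    have hmem : β + 1 ∈ P.model.delta t r := P.mem_delta.2 ⟨hX, fun γ hγ =>
      ((P.mem_delta.1 hβ.1).2 γ hγ).trans (h.finalValue_le_succ ht hlt)⟩
    exact (Nat.lt_succ_self β).not_ge (hβ.2 hmem)
  · obtain ⟨a, ha⟩ := hcomp.exists_isLeast hne
    have hβ := (P.model.delta t r).isLeast_min' (P.delta_nonempty t r)
    refine ⟨_, a, hβ, ha, ?_⟩
    set β := (P.model.delta t r).min' (P.delta_nonempty t r)
    obtain ⟨x, hx, rfl⟩ := ha.1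
    obtain ⟨y, h⟩ := P.exists_isDualCertificate hx
    by_contra! hlt
    obtain ⟨γ, hγ⟩ : ∃ γ, β = γ + 1 := Nat.exists_eq_succ_of_ne_zero fun h0 => by
      rw [h0, Nat.cast_zero] at hlt
      exact hlt.not_ge (h.feasible.2 r).1
    rw [hγ] at hβ hlt
    have hX := (P.mem_delta.1 hβ.1).1
    have hmem : γ ∈ P.model.delta t r := P.mem_delta.2 ⟨by omega, fun η hη =>
      ((P.mem_delta.1 hβ.1).2 η hη).trans (h.finalValue_succ_le ht hX hlt)⟩
    exact (Nat.lt_succ_self γ).not_ge (hβ.2 hmem)
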